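/- Let $m$ be a positive integer, let $n$ be an even positive integer and write $n = N2^t$, where $N$ is an odd positive integer and $t \ge 1$. A linear code $C \subseteq \mathbb{F}_{2^{2m}}^n$ (a linear subspace) is cyclic if $(c_{n-1}, c_0, \ldots, c_{n-2}) \in C$ for all $(c_0, \ldots, c_{n-1}) \in C$, and Hermitian self-dual if $C = C^{\perp_H}$, where $C^{\perp_H} = \{x \in \mathbb{F}_{2^{2m}}^n : \sum_{i=0}^{n-1} x_i c_i^{2^m} = 0 \text{ for all } c \in C\}$. A positive integer $d$ is oddly-good with respect to $(2^m,1)$ if $d$ divides $2^{mk} + 1$ for some odd positive integer $k$; let $OG_{(2^m,1)}$ be the set of these integers. Then the number of Hermitian self-dual cyclic codes of length $n$ over $\mathbb{F}_{2^{2m}}$ is \[ (1+2^t)^{\displaystyle \sum_{d \mid N,\ d \notin OG_{(2^m,1)}} \frac{\Phi(d)}{2\,\mathrm{ord}_d(2^{2m})}}, \] where $\Phi$ is Euler's totient function, $\mathrm{ord}_d(2^{2m})$ is the multiplicative order of $2^{2m}$ modulo $d$ (equal to $1$ for $d = 1$), and every summand in the exponent is an integer. -/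

import Mathlib

/-- `d` is oddly-good with respect to `a` and `b`: it divides `a ^ k + b ^ k` for some odd
positive integer `k`. -/
def IsOddlyGood (a b : ℤ) (d : ℕ) : Prop :=
  ∃ k : ℕ, 0 < k ∧ Odd k ∧ (d : ℤ) ∣ a ^ k + b ^ k

noncomputable instance (a b : ℤ) : DecidablePred (IsOddlyGood a b) :=
  Classical.decPred _

/-- The cyclic shift `(c₀, c₁, …, cₙ₋₁) ↦ (cₙ₋₁, c₀, …, cₙ₋₂)`. -/
def cyclicShift {F : Type*} {n : ℕ} (c : Fin n → F) : Fin n → F :=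
  fun i => c ((finRotate n).symm i)

/-- A linear code of length `n` over `F` is a subspace of `Fⁿ`; it is cyclic if it is closed
under the cyclic shift. -/
def IsCyclicCode {F : Type*} [Field F] {n : ℕ} (C : Submodule F (Fin n → F)) : Prop :=
  ∀ c ∈ C, cyclicShift c ∈ C

/-- The Hermitian inner product `∑ xᵢ yᵢ ^ q` on `Fⁿ`, where `F` has `q ^ 2` elements. -/
def hermitianInner {F : Type*} [Field F] (q : ℕ) {n : ℕ} (x y : Fin n → F) : F :=
  ∑ i, x i * y i ^ q

/-- The Hermitian dual of a linear code over a field with `q ^ 2` elements. -/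
def hermitianDual {F : Type*} [Field F] (q : ℕ) {n : ℕ} (C : Submodule F (Fin n → F)) :
    Submodule F (Fin n → F) where
  carrier := {x | ∀ c ∈ C, hermitianInner q x c = 0}
  add_mem' := by
    intro x y hx hy c hc
    have h1 := hx c hc
    have h2 := hy c hc
    simp only [hermitianInner] at h1 h2 ⊢
    simp [add_mul, Finset.sum_add_distrib, h1, h2]
  zero_mem' := by
    intro c _
    simp [hermitianInner]
  smul_mem' := by
    intro a x hx c hc
    have h1 := hx c hc
    simp only [hermitianInner] at h1 ⊢
    simp [mul_assoc, ← Finset.mul_sum, h1]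

/-- A linear code over a field with `q ^ 2` elements is Hermitian self-dual if it equals its
Hermitian dual. -/
def IsHermitianSelfDual {F : Type*} [Field F] (q : ℕ) {n : ℕ}
    (C : Submodule F (Fin n → F)) : Prop :=
  C = hermitianDual q C

/-! Let q = 2^m and let T be the cyclic shift. A cyclic code is an ideal of F[X]/(X^n - 1), so it
has a unique monic generator g dividing X^n - 1. Up to a power of T, the adjoint of g(T) is g†(T),
with g† the conjugate reciprocal of g; hence the code is self-dual iff g * g† is associated to X^n -
1 (`isHermitianSelfDual_polyCode_iff`).

Over the algebraic closure, X^n - 1 = (X^N - 1)^(2^t), so g amounts to a multiplicity function a on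
the N-th roots of unity, and g† has multiplicity a(ω) at σ(ω) = ω^(-q). Self-duality becomes a(ω) +
a(σ ω) = 2^t. This forces a to be invariant under σ², the Frobenius of F, so every solution comes
from some g over F (`ncard_monic_mul_conjReverse_eq`).

Along a σ-orbit the values alternate between v and 2^t - v: an odd orbit forces 2^(t-1), an even
orbit leaves 1 + 2^t choices (`ncard_add_apply_perm_eq`). The orbit of an ω of order d has length
the order of -q modulo d. This is even exactly when d is not oddly-good, and then equals 2
ord_d(q^2), so the Φ(d) such ω form Φ(d) / (2 ord_d(q^2)) orbits (`card_even_orbits_negPowPerm`). -/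

/-! ### Functions alternating along the orbits of a permutation -/

/-- Every point is an iterate of the chosen representative of its orbit. -/
theorem exists_iterate_out_orbitRel {α : Type*} [Finite α] (σ : Equiv.Perm α) (x : α) :
    ∃ i : ℕ, σ^[i] (Quotient.mk (MulAction.orbitRel (Subgroup.zpowers σ) α) x).out = x := by
  have h : MulAction.orbitRel (Subgroup.zpowers σ) α x
      (Quotient.mk (MulAction.orbitRel (Subgroup.zpowers σ) α) x).out :=
    (MulAction.orbitRel _ _).symm (Quotient.mk_out (s := MulAction.orbitRel _ α) x)
  rw [MulAction.orbitRel_apply] at h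
  obtain ⟨⟨g, hg⟩, hgx⟩ := h
  obtain ⟨i, hi⟩ := (isOfFinOrder_of_finite σ).mem_powers_iff_mem_zpowers.2 hg
  refine ⟨i, ?_⟩
  have hi' : σ ^ i = g := hi
  have hgx' : g (Quotient.mk (MulAction.orbitRel (Subgroup.zpowers σ) α) x).out = x := hgx
  rw [Equiv.Perm.iterate_eq_pow, hi', hgx']

/-- The difference of the exponents is a multiple of the even period, so the parity of a position on
an even orbit is well defined. -/
theorem even_iff_even_of_iterate_eq {α : Type*} (σ : Equiv.Perm α) {r : α}
    (he : Even (Function.minimalPeriod σ r)) {k l : ℕ} (h : σ^[k] r = σ^[l] r) :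
    Even k ↔ Even l := by
  wlog hkl : k ≤ l generalizing k l
  · exact (this h.symm (by omega)).symm
  obtain ⟨j, rfl⟩ := Nat.exists_eq_add_of_le hkl
  rw [Function.iterate_add_apply] at h
  have h1 : σ^[j] r = r := ((σ.injective.iterate k) h).symm
  have h2 : Even j := he.trans_dvd (Function.IsPeriodicPt.minimalPeriod_dvd h1)
  rw [Nat.even_add]
  tauto

/-- Each application of `σ` reflects the value about `s`. The truncated subtraction is harmless,
since every value is at most `2 * s`. -/
theorem apply_iterate_of_add_apply_eq {α : Type*} {σ : α → α} {s : ℕ} {a : α → ℕ}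
    (ha : ∀ x, a x + a (σ x) = 2 * s) (k : ℕ) (x : α) :
    a (σ^[k] x) = if Even k then a x else 2 * s - a x := by
  induction k with
  | zero => simp
  | succ k ih =>
    have h1 := ha (σ^[k] x)
    have h2 := ha x
    rw [Function.iterate_succ_apply']
    by_cases hk : Even k
    · rw [if_pos hk] at ih
      rw [if_neg (by rw [Nat.even_add_one]; simpa using hk)]
      omega
    · rw [if_neg hk] at ih
      rw [if_pos (by rw [Nat.even_add_one]; exact hk)]
      omega

open Function in
/-- The functions `a` with `a x + a (σ x) = 2 * s` are determined by their values at one point of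
each `σ`-orbit of even length, and these values are arbitrary in `{0, …, 2 * s}`. -/
theorem ncard_add_apply_perm_eq {α : Type*} [Finite α] (σ : Equiv.Perm α) (s : ℕ) :
    Set.ncard {a : α → ℕ | ∀ x, a x + a (σ x) = 2 * s} =
      (1 + 2 * s) ^ Nat.card {o : MulAction.orbitRel.Quotient (Subgroup.zpowers σ) α //
        Even (minimalPeriod σ o.out)} := by
  classical
  set Q := MulAction.orbitRel.Quotient (Subgroup.zpowers σ) α with hQ
  let mk : α → Q := Quotient.mk _
  choose i hi using exists_iterate_out_orbitRel σ
  change ∀ x, σ^[i x] (mk x).out = x at hi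
  have hmkσ : ∀ x, mk (σ x) = mk x := by
    intro x
    refine Quotient.sound (s := MulAction.orbitRel _ α) ?_
    change MulAction.orbitRel (Subgroup.zpowers σ) α _ _
    rw [MulAction.orbitRel_apply]
    exact ⟨⟨σ, Subgroup.mem_zpowers σ⟩, rfl⟩
  have hmkout : ∀ o : Q, mk o.out = o := fun o => Quotient.out_eq o
  have hflip : ∀ x, Even (minimalPeriod σ (mk x).out) → (Even (i (σ x)) ↔ ¬ Even (i x)) := by
    intro x he
    rw [← Nat.even_add_one]
    refine even_iff_even_of_iterate_eq σ he ?_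
    rw [iterate_succ_apply', hi x]
    conv_lhs => rw [← hmkσ x]
    exact hi (σ x)
  let E := {o : Q // Even (minimalPeriod σ o.out)}
  -- Inverse of restriction to the representatives: on an even orbit the prescribed value and its
  -- reflection alternate, on an odd orbit the value is constantly `s`.
  let Φ : (E → Fin (1 + 2 * s)) → α → ℕ := fun b x =>
    if h : Even (minimalPeriod σ (mk x).out) then
      if Even (i x) then (b ⟨mk x, h⟩ : ℕ) else 2 * s - b ⟨mk x, h⟩
    else s
  have hinj : Injective Φ := by
    intro b b' h
    ext ⟨o, ho⟩
    have h1 := congrFun h o.out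
    have h2 : Even (i o.out) := by
      refine (even_iff_even_of_iterate_eq σ ho (l := 0) ?_).2 (by simp)
      have := hi o.out
      rwa [hmkout] at this
    simpa [Φ, hmkout, ho, h2] using h1
  have hrange : {a : α → ℕ | ∀ x, a x + a (σ x) = 2 * s} = Set.range Φ := by
    ext a
    constructor
    · intro ha
      have ha' : ∀ x, a x + a (σ x) = 2 * s := ha
      refine ⟨fun o => ⟨a o.1.out, by have := ha' o.1.out; omega⟩, ?_⟩
      funext x
      have hx := apply_iterate_of_add_apply_eq ha' (i x) (mk x).out
      rw [hi] at hx
      by_cases he : Even (minimalPeriod σ (mk x).out)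
      · simp only [Φ, dif_pos he]
        exact hx.symm
      -- Going once round an odd orbit reflects the value to itself, so it equals `s`.
      · have hp := apply_iterate_of_add_apply_eq ha' (minimalPeriod σ (mk x).out) (mk x).out
        rw [iterate_minimalPeriod, if_neg he] at hp
        have h0 := ha' (mk x).out
        simp only [Φ, dif_neg he]
        split_ifs at hx <;> omega
    · rintro ⟨b, rfl⟩ x
      by_cases he : Even (minimalPeriod σ (mk x).out)
      · have he' : Even (minimalPeriod σ (mk (σ x)).out) := by rwa [hmkσ]
        have hb : (⟨mk (σ x), he'⟩ : E) = ⟨mk x, he⟩ := Subtype.ext (hmkσ x)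
        have hlt := (b ⟨mk x, he⟩).2
        simp only [Φ, dif_pos he, dif_pos he', hb]
        by_cases hx : Even (i x)
        · rw [if_pos hx, if_neg (by rw [hflip x he]; simpa using hx)]
          omega
        · rw [if_neg hx, if_pos (by rw [hflip x he]; exact hx)]
          omega
      · have he' : ¬ Even (minimalPeriod σ (mk (σ x)).out) := by rwa [hmkσ]
        simp only [Φ, dif_neg he, dif_neg he']
        omega
  rw [hrange, ← Set.image_univ, Set.ncard_image_of_injective _ hinj, Set.ncard_univ,
    Nat.card_fun, Nat.card_fin]

open Function in
/-- The number of orbits of even length is the sum over all points on such orbits of the inverse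
of the length of the orbit. -/
theorem card_even_orbits_eq_sum {α : Type*} [Fintype α] (σ : Equiv.Perm α) :
    (Nat.card {o : MulAction.orbitRel.Quotient (Subgroup.zpowers σ) α //
        Even (minimalPeriod σ o.out)} : ℚ) =
      ∑ x : α, if Even (minimalPeriod σ x) then (minimalPeriod σ x : ℚ)⁻¹ else 0 := by
  classical
  set Q := MulAction.orbitRel.Quotient (Subgroup.zpowers σ) α with hQ
  let mk : α → Q := Quotient.mk _
  have hper : ∀ x, minimalPeriod σ x = minimalPeriod σ (mk x).out := by
    intro x
    obtain ⟨i, hi⟩ := exists_iterate_out_orbitRel σ x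
    conv_lhs => rw [← hi]
    exact minimalPeriod_apply_iterate
      (σ.injective.mem_periodicPts _) i
  rw [Nat.card_eq_fintype_card, Fintype.card_subtype, ← Finset.sum_fiberwise _ mk,
    Finset.card_filter, Nat.cast_sum]
  refine Finset.sum_congr rfl fun o _ => ?_
  -- Each orbit contributes as many equal terms as its length, hence 1 in total if that length is
  -- even.
  have hcard : (Finset.univ.filter fun x => mk x = o).card = minimalPeriod σ o.out := by
    have h := MulAction.minimalPeriod_eq_card (a := σ) (b := o.out)
    change minimalPeriod σ o.out = _ at h
    rw [h, ← Set.toFinset_card]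
    congr 1
    ext x
    rw [Finset.mem_filter, Set.mem_toFinset, ← MulAction.orbitRel_apply]
    have : mk x = o ↔ mk x = mk o.out := by rw [show mk o.out = o from Quotient.out_eq o]
    simp only [Finset.mem_univ, true_and, this]
    exact Quotient.eq (r := MulAction.orbitRel (Subgroup.zpowers σ) α)
  have hpos : 0 < minimalPeriod σ o.out :=
    minimalPeriod_pos_of_mem_periodicPts (σ.injective.mem_periodicPts _)
  rw [Finset.sum_congr rfl (g := fun _ => if Even (minimalPeriod σ o.out) then
    (minimalPeriod σ o.out : ℚ)⁻¹ else 0), Finset.sum_const, hcard]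
  · split_ifs
    · simp [hpos.ne']
    · simp
  · intro x hx
    rw [hper x, (Finset.mem_filter.1 hx).2]

/-! ### Oddly-good numbers and the order of -q -/

/-- A number is oddly-good with respect to `(q, 1)` iff `-q` has odd order modulo it. -/
theorem isOddlyGood_one_iff_odd_orderOf_neg (q : ℤ) (d : ℕ) :
    IsOddlyGood q 1 d ↔ Odd (orderOf (-(q : ZMod d))) := by
  have key : ∀ k : ℕ, Odd k → ((d : ℤ) ∣ q ^ k + 1 ^ k ↔ (-(q : ZMod d)) ^ k = 1) := by
    intro k hk
    rw [← CharP.intCast_eq_zero_iff (ZMod d) d, hk.neg_pow]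
    push_cast
    rw [one_pow, add_eq_zero_iff_eq_neg, neg_eq_iff_eq_neg]
  constructor
  · rintro ⟨k, -, hk, hd⟩
    exact hk.of_dvd_nat (orderOf_dvd_of_pow_eq_one ((key k hk).1 hd))
  · intro h
    exact ⟨_, h.pos, h, (key _ h).2 (pow_orderOf_eq_one _)⟩

theorem not_isOddlyGood_one_iff_even_orderOf_neg (q : ℤ) (d : ℕ) :
    ¬ IsOddlyGood q 1 d ↔ Even (orderOf (-(q : ZMod d))) := by
  rw [isOddlyGood_one_iff_odd_orderOf_neg, Nat.not_odd_iff_even]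

/-- `-x` and `x` have the same square, and squaring halves an even order. -/
theorem orderOf_neg_eq_two_mul_orderOf_sq {R : Type*} [CommRing R] (x : R)
    (h : Even (orderOf (-x))) : orderOf (-x) = 2 * orderOf (x ^ 2) := by
  rw [← neg_sq, orderOf_pow' _ two_ne_zero, Nat.gcd_eq_right h.two_dvd]
  exact (Nat.mul_div_cancel' h.two_dvd).symm

/-- Euler's theorem for the unit -q; this is the source of the integrality of the exponents. -/
theorem orderOf_neg_natCast_dvd_totient {q d : ℕ} (h : q.Coprime d) :
    orderOf (-(q : ZMod d)) ∣ d.totient := by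
  apply orderOf_dvd_of_pow_eq_one
  have h1 := congrArg Units.val (ZMod.pow_totient (-(ZMod.unitOfCoprime q h)))
  rwa [Units.val_pow_eq_pow_val, Units.val_neg, ZMod.coe_unitOfCoprime, Units.val_one] at h1

/-! ### Orbits of the map x ↦ x^(-q) -/

/-- The permutation `x ↦ x ^ (-q)` of a finite commutative group whose order is prime to `q`. -/
noncomputable def negPowPerm {G : Type*} [CommGroup G] {q : ℕ} (h : (Nat.card G).Coprime q) :
    Equiv.Perm G :=
  (powCoprime h).trans (Equiv.inv G)

theorem negPowPerm_apply {G : Type*} [CommGroup G] {q : ℕ} (h : (Nat.card G).Coprime q) (x : G) :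
    negPowPerm h x = (x ^ q)⁻¹ :=
  rfl

theorem iterate_negPowPerm {G : Type*} [CommGroup G] {q : ℕ} (h : (Nat.card G).Coprime q)
    (k : ℕ) (x : G) : (negPowPerm h)^[k] x = x ^ ((-(q : ℤ)) ^ k) := by
  induction k with
  | zero => simp
  | succ k ih =>
    rw [Function.iterate_succ_apply', ih, negPowPerm_apply, pow_succ, zpow_mul, zpow_neg,
      zpow_natCast]

/-- The k-th iterate is x ↦ x^((-q)^k), which fixes x iff (-q)^k ≡ 1 modulo the order of x. -/
theorem minimalPeriod_negPowPerm {G : Type*} [CommGroup G] {q : ℕ}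
    (h : (Nat.card G).Coprime q) (x : G) :
    Function.minimalPeriod (negPowPerm h) x = orderOf (-(q : ZMod (orderOf x))) := by
  rw [orderOf, Function.minimalPeriod_eq_minimalPeriod_iff]
  intro k
  rw [isPeriodicPt_mul_iff_pow_eq_one, Function.IsPeriodicPt, Function.IsFixedPt,
    iterate_negPowPerm, ← mul_inv_eq_one, ← zpow_sub_one, ← orderOf_dvd_iff_zpow_eq_one,
    ← CharP.intCast_eq_zero_iff (ZMod (orderOf x)) (orderOf x)]
  push_cast
  rw [sub_eq_zero]

/-- In a cyclic group of order `N` prime to `q`, the number of even-length cycles of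
`x ↦ x ^ (-q)`, sorted by the order of `x`. -/
theorem card_even_orbits_negPowPerm {G : Type*} [CommGroup G] [Finite G] [IsCyclic G] {q : ℕ}
    (h : (Nat.card G).Coprime q) :
    Nat.card {o : MulAction.orbitRel.Quotient (Subgroup.zpowers (negPowPerm h)) G //
        Even (Function.minimalPeriod (negPowPerm h) o.out)} =
      ∑ d ∈ (Nat.card G).divisors with ¬ IsOddlyGood q 1 d,
        d.totient / (2 * orderOf ((q : ZMod d) ^ 2)) := by
  classical
  cases nonempty_fintype G
  have hcop : ∀ d ∈ (Nat.card G).divisors, q.Coprime d := fun d hd =>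
    (h.coprime_dvd_left (Nat.dvd_of_mem_divisors hd)).symm
  have hnot : ∀ d : ℕ, ¬ IsOddlyGood q 1 d ↔ Even (orderOf (-(q : ZMod d))) := fun d => by
    simpa using not_isOddlyGood_one_iff_even_orderOf_neg q d
  have hq : ∀ d ∈ (Nat.card G).divisors, ¬ IsOddlyGood q 1 d →
      d.totient / (2 * orderOf ((q : ZMod d) ^ 2)) =
        d.totient / orderOf (-(q : ZMod d)) := fun d _ hd => by
    rw [orderOf_neg_eq_two_mul_orderOf_sq _ ((hnot d).1 hd)]
  apply Nat.cast_injective (R := ℚ)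
  rw [card_even_orbits_eq_sum, Finset.sum_filter, Nat.cast_sum,
    ← Finset.sum_fiberwise_of_maps_to (t := (Nat.card G).divisors) (g := orderOf)
      (fun x _ => Nat.mem_divisors.2 ⟨orderOf_dvd_natCard x, Nat.card_pos.ne'⟩)]
  refine Finset.sum_congr rfl fun d hd => ?_
  have hconst : ∀ x ∈ Finset.univ.filter (fun x : G => orderOf x = d),
      (if Even (Function.minimalPeriod (negPowPerm h) x) then
        (Function.minimalPeriod (negPowPerm h) x : ℚ)⁻¹ else 0) =
      if Even (orderOf (-(q : ZMod d))) then (orderOf (-(q : ZMod d)) : ℚ)⁻¹ else 0 := by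
    intro x hx
    rw [minimalPeriod_negPowPerm, (Finset.mem_filter.1 hx).2]
  rw [Finset.sum_congr rfl hconst, Finset.sum_const, IsCyclic.card_orderOf_eq_totient
    (by rw [← Nat.card_eq_fintype_card]; exact Nat.dvd_of_mem_divisors hd)]
  by_cases hd' : IsOddlyGood q 1 d
  · have : ¬ Even (orderOf (-(q : ZMod d))) := by rw [← hnot]; exact not_not.2 hd'
    rw [if_neg this, if_neg (not_not.2 hd')]
    simp
  · rw [if_pos ((hnot d).1 hd'), if_pos hd', hq d hd hd',
      Nat.cast_div_charZero (orderOf_neg_natCast_dvd_totient (hcop d hd)), nsmul_eq_mul,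
      div_eq_mul_inv]

/-! ### Cyclic codes and divisors of X^n - 1 -/

section CyclicCodes

open Polynomial

variable {F : Type*} [Field F] {n : ℕ}

/-- The cyclic shift as a linear map. -/
def shiftMap (F : Type*) [Field F] (n : ℕ) : (Fin n → F) →ₗ[F] (Fin n → F) :=
  LinearMap.funLeft F F (finRotate n).symm

theorem shiftMap_apply (c : Fin n → F) : shiftMap F n c = cyclicShift c :=
  rfl

/-- The polynomial `∑ cᵢ Xⁱ` of a word `c`. -/
noncomputable def wordPoly (c : Fin n → F) : F[X] :=
  ∑ i : Fin n, C (c i) * X ^ (i : ℕ)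

theorem wordPoly_add (c d : Fin n → F) : wordPoly (c + d) = wordPoly c + wordPoly d := by
  simp [wordPoly, add_mul, Finset.sum_add_distrib]

theorem wordPoly_smul (a : F) (c : Fin n → F) : wordPoly (a • c) = C a * wordPoly c := by
  simp [wordPoly, Finset.mul_sum, mul_assoc]

theorem wordPoly_coeff_eq_modByMonic [NeZero n] (p : F[X]) :
    wordPoly (fun i : Fin n => (p %ₘ (X ^ n - 1)).coeff i) = p %ₘ (X ^ n - 1) := by
  have hm : (X ^ n - 1 : F[X]).Monic := monic_X_pow_sub_C (1 : F) (NeZero.ne n)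
  conv_rhs => rw [(p %ₘ (X ^ n - 1)).as_sum_range' n (by
    have h := natDegree_modByMonic_lt p hm (by
      intro h
      have := congrArg natDegree h
      rw [natDegree_one, show (X ^ n - 1 : F[X]) = X ^ n - C 1 by simp,
        natDegree_X_pow_sub_C] at this
      exact NeZero.ne n this)
    rwa [show (X ^ n - 1 : F[X]) = X ^ n - C 1 by simp, natDegree_X_pow_sub_C] at h)]
  simp only [wordPoly, C_mul_X_pow_eq_monomial]
  exact Fin.sum_univ_eq_sum_range (fun i => monomial i ((p %ₘ (X ^ n - 1)).coeff i)) n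

theorem shiftMap_pow_single [NeZero n] (j : ℕ) :
    (shiftMap F n ^ j) (Pi.single 0 1) = Pi.single (Fin.ofNat n j) 1 := by
  induction j with
  | zero => simp
  | succ j ih =>
    rw [pow_succ', Module.End.mul_apply, ih]
    ext i
    rw [shiftMap_apply, cyclicShift, finRotate_symm_apply]
    simp only [Pi.single_apply]
    congr 1
    rw [sub_eq_iff_eq_add]
    have : Fin.ofNat n (j + 1) = Fin.ofNat n j + 1 := by
      exact Fin.ext (by simp [Fin.ofNat, Fin.val_add, Nat.add_mod])
    rw [this]

/-- The first basis vector e₀ is a cyclic vector for the shift T. Thus p ↦ p(T) e₀ maps F[X] onto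
the words, with `wordPoly` as a section. -/
theorem aeval_wordPoly_single [NeZero n] (c : Fin n → F) :
    aeval (shiftMap F n) (wordPoly c) (Pi.single 0 1) = c := by
  simp only [wordPoly, map_sum, map_mul, aeval_C, map_pow, aeval_X, LinearMap.sum_apply,
    Module.End.mul_apply, shiftMap_pow_single, Module.algebraMap_end_apply]
  conv_rhs => rw [pi_eq_sum_univ' c]
  refine Finset.sum_congr rfl fun i _ => ?_
  ext j
  simp [Pi.single_apply, eq_comm]

/-- T^n - 1 kills e₀ and commutes with T, so it kills every basis vector T^i e₀. -/
theorem aeval_shiftMap_X_pow_sub_one [NeZero n] :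
    aeval (shiftMap F n) (X ^ n - 1 : F[X]) = 0 := by
  have h0 : (aeval (shiftMap F n) (X ^ n - 1 : F[X])) (Pi.single 0 1) = 0 := by
    simp [shiftMap_pow_single]
  ext1 i
  ext1
  have := shiftMap_pow_single (F := F) (n := n) i
  rw [Fin.ofNat_eq_cast, Fin.cast_val_eq_self] at this
  rw [LinearMap.comp_apply, LinearMap.coe_single, ← this,
    show shiftMap F n ^ (i : ℕ) = aeval (shiftMap F n) (X ^ (i : ℕ) : F[X]) by simp,
    ← Module.End.mul_apply, ← map_mul, mul_comm, map_mul, Module.End.mul_apply, h0]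
  simp

theorem aeval_shiftMap_single_eq_zero_iff [NeZero n] (p : F[X]) :
    aeval (shiftMap F n) p (Pi.single 0 1) = 0 ↔ X ^ n - 1 ∣ p := by
  have hm : (X ^ n - 1 : F[X]).Monic := monic_X_pow_sub_C (1 : F) (NeZero.ne n)
  constructor
  · intro h
    rw [← modByMonic_add_div p (X ^ n - 1), map_add, map_mul, aeval_shiftMap_X_pow_sub_one,
      zero_mul, add_zero, ← wordPoly_coeff_eq_modByMonic, aeval_wordPoly_single] at h
    rw [← modByMonic_eq_zero_iff_dvd hm, ← wordPoly_coeff_eq_modByMonic, h]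
    simp [wordPoly]
  · rintro ⟨r, rfl⟩
    rw [map_mul, aeval_shiftMap_X_pow_sub_one]
    simp

theorem X_pow_sub_one_dvd_wordPoly_aeval_sub [NeZero n] (p : F[X]) :
    X ^ n - 1 ∣ wordPoly (aeval (shiftMap F n) p (Pi.single 0 1)) - p := by
  rw [← aeval_shiftMap_single_eq_zero_iff, map_sub, LinearMap.sub_apply, aeval_wordPoly_single,
    sub_self]

/-- The code consisting of the words whose polynomial is a multiple of `g`. -/
noncomputable def polyCode (n : ℕ) (g : F[X]) : Submodule F (Fin n → F) where
  carrier := {c | g ∣ wordPoly c}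
  add_mem' := by
    intro a b ha hb
    rw [Set.mem_ofPred_eq, wordPoly_add]
    exact dvd_add ha hb
  zero_mem' := by simp [wordPoly]
  smul_mem' := by
    intro a c hc
    rw [Set.mem_ofPred_eq, wordPoly_smul]
    exact Dvd.dvd.mul_left hc _

theorem mem_polyCode {g : F[X]} {c : Fin n → F} : c ∈ polyCode n g ↔ g ∣ wordPoly c :=
  Iff.rfl

theorem aeval_single_mem_polyCode_iff [NeZero n] {g : F[X]} (hg : g ∣ X ^ n - 1) (p : F[X]) :
    aeval (shiftMap F n) p (Pi.single 0 1) ∈ polyCode n g ↔ g ∣ p := by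
  rw [mem_polyCode]
  exact dvd_iff_dvd_of_dvd_sub (hg.trans (X_pow_sub_one_dvd_wordPoly_aeval_sub p))

theorem isCyclicCode_polyCode [NeZero n] {g : F[X]} (hg : g ∣ X ^ n - 1) :
    IsCyclicCode (polyCode n g) := by
  intro c hc
  have h : cyclicShift c = aeval (shiftMap F n) (X * wordPoly c) (Pi.single 0 1) := by
    rw [map_mul, Module.End.mul_apply, aeval_wordPoly_single, aeval_X, shiftMap_apply]
  rw [h, aeval_single_mem_polyCode_iff hg]
  exact Dvd.dvd.mul_left hc X

/-- Testing the membership of g(T) e₀ and h(T) e₀ in the common code shows that the two generators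
divide each other. -/
theorem polyCode_injOn [NeZero n] :
    Set.InjOn (polyCode (F := F) n) {g | g.Monic ∧ g ∣ X ^ n - 1} := by
  rintro g ⟨hgm, hg⟩ h ⟨hhm, hh⟩ hgh
  refine eq_of_monic_of_associated hgm hhm (associated_of_dvd_dvd ?_ ?_)
  · rw [← aeval_single_mem_polyCode_iff hg, hgh, aeval_single_mem_polyCode_iff hh]
  · rw [← aeval_single_mem_polyCode_iff hh, ← hgh, aeval_single_mem_polyCode_iff hg]

theorem IsCyclicCode.aeval_mem {C : Submodule F (Fin n → F)} (hC : IsCyclicCode C) (p : F[X])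
    {c : Fin n → F} (hc : c ∈ C) : aeval (shiftMap F n) p c ∈ C := by
  induction p using Polynomial.induction_on' with
  | add p r hp hr =>
    rw [map_add, LinearMap.add_apply]
    exact C.add_mem hp hr
  | monomial k a =>
    rw [aeval_monomial, Module.End.mul_apply, Module.algebraMap_end_apply]
    refine C.smul_mem _ ?_
    induction k with
    | zero => simpa using hc
    | succ k ih =>
      rw [pow_succ', Module.End.mul_apply]
      exact hC _ ih

/-- The preimage of the code under p ↦ p(T) e₀ is an ideal of the principal ideal domain F[X], and
it contains X^n - 1. -/
theorem IsCyclicCode.exists_eq_polyCode [NeZero n] {C : Submodule F (Fin n → F)}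
    (hC : IsCyclicCode C) : ∃ g : F[X], g.Monic ∧ g ∣ X ^ n - 1 ∧ C = polyCode n g := by
  classical
  let I : Ideal F[X] :=
    { carrier := {p | aeval (shiftMap F n) p (Pi.single 0 1) ∈ C}
      add_mem' := by
        intro a b ha hb
        rw [Set.mem_ofPred_eq, map_add, LinearMap.add_apply]
        exact C.add_mem ha hb
      zero_mem' := by simp
      smul_mem' := by
        intro a b hb
        rw [Set.mem_ofPred_eq, smul_eq_mul, map_mul, Module.End.mul_apply]
        exact hC.aeval_mem a hb }
  have hI : ∀ p, p ∈ I ↔ aeval (shiftMap F n) p (Pi.single 0 1) ∈ C := fun p => Iff.rfl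
  obtain ⟨g, hg⟩ := (IsPrincipalIdealRing.principal I).principal
  have hdvd : ∀ p, p ∈ I ↔ g ∣ p := by
    intro p
    rw [hg]
    exact Ideal.mem_span_singleton
  have hgP : g ∣ X ^ n - 1 := by
    rw [← hdvd, hI, aeval_shiftMap_X_pow_sub_one]
    simp
  have hg0 : g ≠ 0 := by
    rintro rfl
    exact (monic_X_pow_sub_C (1 : F) (NeZero.ne n)).ne_zero (by simpa using hgP)
  refine ⟨normalize g, monic_normalize hg0, normalize_dvd_iff.2 hgP, ?_⟩
  ext c
  rw [mem_polyCode, normalize_dvd_iff, ← hdvd, hI, aeval_wordPoly_single]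

end CyclicCodes

/-! ### The Hermitian dual in terms of the generator polynomial -/

section HermitianDual

open Polynomial

variable {F : Type*} [Field F] {n : ℕ}

theorem hermitianInner_shiftMap (q : ℕ) (x y : Fin n → F) :
    hermitianInner q (shiftMap F n x) (shiftMap F n y) = hermitianInner q x y :=
  Equiv.sum_comp (finRotate n).symm fun i => x i * y i ^ q

theorem hermitianInner_shiftMap_pow (q k : ℕ) (x y : Fin n → F) :
    hermitianInner q ((shiftMap F n ^ k) x) ((shiftMap F n ^ k) y) = hermitianInner q x y := by
  induction k with
  | zero => simp
  | succ k ih =>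
    rw [pow_succ', Module.End.mul_apply, Module.End.mul_apply, hermitianInner_shiftMap, ih]

theorem hermitianInner_sum_left (q : ℕ) {ι : Type*} (s : Finset ι) (x : ι → Fin n → F)
    (y : Fin n → F) :
    hermitianInner q (∑ i ∈ s, x i) y = ∑ i ∈ s, hermitianInner q (x i) y := by
  simp only [hermitianInner, Finset.sum_apply, Finset.sum_mul]
  exact Finset.sum_comm

theorem hermitianInner_smul_left (q : ℕ) (a : F) (x y : Fin n → F) :
    hermitianInner q (a • x) y = a * hermitianInner q x y := by
  simp [hermitianInner, Finset.mul_sum, mul_assoc]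

theorem hermitianInner_sum_right {q : ℕ} {φ : F →+* F} (hφ : ∀ x, φ x = x ^ q) {ι : Type*}
    (s : Finset ι) (x : Fin n → F) (y : ι → Fin n → F) :
    hermitianInner q x (∑ i ∈ s, y i) = ∑ i ∈ s, hermitianInner q x (y i) := by
  simp only [hermitianInner, Finset.sum_apply, ← hφ, map_sum, Finset.mul_sum]
  exact Finset.sum_comm

theorem hermitianInner_smul_right (q : ℕ) (a : F) (x y : Fin n → F) :
    hermitianInner q x (a • y) = a ^ q * hermitianInner q x y := by
  simp only [hermitianInner, Pi.smul_apply, smul_eq_mul, mul_pow, Finset.mul_sum]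
  exact Finset.sum_congr rfl fun i _ => by ring

theorem hermitianInner_single_right {q : ℕ} (hq : q ≠ 0) (x : Fin n → F) (i : Fin n) :
    hermitianInner q x (Pi.single i 1) = x i := by
  classical
  rw [hermitianInner, Finset.sum_eq_single i]
  · simp
  · intro j _ hj
    simp [Pi.single_eq_of_ne hj, hq]
  · simp

/-- The conjugate reciprocal polynomial of `g`, with conjugation given by `φ`. -/
noncomputable def conjReverse {K : Type*} [Field K] (φ : K →+* K) (g : K[X]) : K[X] :=
  (g.map φ).reverse

/-- Up to a power of the shift, the adjoint of `g(T)` is `g†(T)`, where `g†` is the conjugate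
reciprocal of `g`. -/
theorem hermitianInner_aeval_right {q : ℕ} {φ : F →+* F} (hφ : ∀ x, φ x = x ^ q) (g : F[X])
    (x y : Fin n → F) :
    hermitianInner q ((shiftMap F n ^ g.natDegree) x) (aeval (shiftMap F n) g y) =
      hermitianInner q (aeval (shiftMap F n) (conjReverse φ g) x) y := by
  have hd : (conjReverse φ g).natDegree < g.natDegree + 1 := by
    refine Nat.lt_succ_of_le ((reverse_natDegree_le _).trans ?_)
    rw [natDegree_map]
  rw [aeval_eq_sum_range, aeval_eq_sum_range' hd, LinearMap.sum_apply, LinearMap.sum_apply,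
    hermitianInner_sum_right hφ, hermitianInner_sum_left]
  -- Reversal moves the coefficient at i to deg g - i; after reflecting one sum the two agree term
  -- by term, since T preserves the form.
  rw [← Finset.sum_range_reflect]
  refine Finset.sum_congr rfl fun i hi => ?_
  have hi' : i ≤ g.natDegree := Nat.lt_succ_iff.1 (Finset.mem_range.1 hi)
  rw [LinearMap.smul_apply, LinearMap.smul_apply, hermitianInner_smul_left,
    hermitianInner_smul_right, conjReverse, coeff_reverse, natDegree_map, revAt_le hi', coeff_map,
    hφ, show g.natDegree + 1 - 1 - i = g.natDegree - i by omega]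
  congr 1
  have h : shiftMap F n ^ g.natDegree = shiftMap F n ^ (g.natDegree - i) * shiftMap F n ^ i := by
    rw [← pow_add, Nat.sub_add_cancel hi']
  rw [h, Module.End.mul_apply, hermitianInner_shiftMap_pow]

/-- Moving g(T) across the form, x is orthogonal to all g(T) p(T) e₀ iff g†(T) x is orthogonal to
everything, that is, iff g†(T) x = 0. -/
theorem mem_hermitianDual_polyCode_iff [NeZero n] {q : ℕ} (hq : q ≠ 0) {φ : F →+* F}
    (hφ : ∀ x, φ x = x ^ q) {g : F[X]} (hg : g ∣ X ^ n - 1) (x : Fin n → F) :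
    x ∈ hermitianDual q (polyCode n g) ↔ X ^ n - 1 ∣ conjReverse φ g * wordPoly x := by
  have key : ∀ p : F[X], hermitianInner q x (aeval (shiftMap F n) (g * p) (Pi.single 0 1)) =
      hermitianInner q (aeval (shiftMap F n) (conjReverse φ g) x)
        ((shiftMap F n ^ g.natDegree) (aeval (shiftMap F n) p (Pi.single 0 1))) := by
    intro p
    rw [← hermitianInner_aeval_right hφ, ← hermitianInner_shiftMap_pow q g.natDegree x]
    congr 1
    have h : shiftMap F n ^ g.natDegree = aeval (shiftMap F n) (X ^ g.natDegree : F[X]) := by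
      simp
    rw [h]
    simp only [← Module.End.mul_apply, ← map_mul]
    congr 2
    ring
  have hx : aeval (shiftMap F n) (conjReverse φ g) x =
      aeval (shiftMap F n) (conjReverse φ g * wordPoly x) (Pi.single 0 1) := by
    rw [map_mul, Module.End.mul_apply, aeval_wordPoly_single]
  rw [← aeval_shiftMap_single_eq_zero_iff, ← hx]
  constructor
  · intro h
    ext i
    -- The summand (n - 1) * deg g in the exponent undoes the factor T^(deg g) coming from the
    -- adjoint, because T^n = 1; what remains is the i-th basis vector.
    have hmem := h _ ((aeval_single_mem_polyCode_iff hg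
      (g * X ^ ((i : ℕ) + (n - 1) * g.natDegree))).2 (dvd_mul_right _ _))
    rw [key] at hmem
    have hpow : (shiftMap F n ^ g.natDegree) (aeval (shiftMap F n)
        (X ^ ((i : ℕ) + (n - 1) * g.natDegree) : F[X]) (Pi.single 0 1)) = Pi.single i 1 := by
      rw [map_pow, aeval_X, ← Module.End.mul_apply, ← pow_add, shiftMap_pow_single]
      congr 1
      apply Fin.ext
      have h1 : g.natDegree + ((i : ℕ) + (n - 1) * g.natDegree) = i + n * g.natDegree := by
        have h2 : n - 1 + 1 = n := Nat.sub_add_cancel (NeZero.one_le)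
        calc _ = (i : ℕ) + (n - 1 + 1) * g.natDegree := by ring
          _ = _ := by rw [h2]
      rw [h1]
      simp [Fin.ofNat, Nat.mod_eq_of_lt i.2]
    rw [hpow, hermitianInner_single_right hq] at hmem
    exact hmem
  · intro h c hc
    obtain ⟨p, hp⟩ := hc
    rw [← aeval_wordPoly_single c, hp, key, h]
    simp [hermitianInner]

theorem conjReverse_mul {K : Type*} [Field K] (φ : K →+* K) (f g : K[X]) :
    conjReverse φ (f * g) = conjReverse φ f * conjReverse φ g := by
  rw [conjReverse, Polynomial.map_mul, reverse_mul_of_domain]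
  rfl

theorem conjReverse_ne_zero {K : Type*} [Field K] {φ : K →+* K} {g : K[X]} (hg : g ≠ 0) :
    conjReverse φ g ≠ 0 := by
  rw [conjReverse, Ne, reverse_eq_zero]
  exact (Polynomial.map_ne_zero_iff φ.injective).2 hg

theorem conjReverse_X_pow_sub_one {K : Type*} [Field K] (φ : K →+* K) (n : ℕ) :
    conjReverse φ (X ^ n - 1) = -(X ^ n - 1) := by
  rw [conjReverse, Polynomial.map_sub, Polynomial.map_pow, map_X, Polynomial.map_one, reverse,
    show (X ^ n - 1 : K[X]) = X ^ n - C 1 by simp, natDegree_X_pow_sub_C, reflect_sub,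
    reflect_monomial, reflect_C, revAt_le le_rfl]
  simp

/-- Self-duality of the cyclic code with generator `g` in terms of `g`. -/
theorem isHermitianSelfDual_polyCode_iff [NeZero n] {q : ℕ} (hq : q ≠ 0) {φ : F →+* F}
    (hφ : ∀ x, φ x = x ^ q) {g : F[X]} (hg : g ∣ X ^ n - 1) :
    IsHermitianSelfDual q (polyCode n g) ↔ Associated (g * conjReverse φ g) (X ^ n - 1) := by
  have hP : (X ^ n - 1 : F[X]) ≠ 0 := (monic_X_pow_sub_C (1 : F) (NeZero.ne n)).ne_zero
  have hg0 : g ≠ 0 := ne_zero_of_dvd_ne_zero hP hg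
  have hg0' : conjReverse φ g ≠ 0 := conjReverse_ne_zero hg0
  constructor
  · intro h
    have hall : ∀ p : F[X], g ∣ p ↔ X ^ n - 1 ∣ conjReverse φ g * p := by
      intro p
      rw [← aeval_single_mem_polyCode_iff hg, h, mem_hermitianDual_polyCode_iff hq hφ hg]
      apply dvd_iff_dvd_of_dvd_sub
      rw [← mul_sub]
      exact Dvd.dvd.mul_left (X_pow_sub_one_dvd_wordPoly_aeval_sub p) _
    obtain ⟨k, hk⟩ : conjReverse φ g ∣ X ^ n - 1 := by
      obtain ⟨k, hk⟩ := hg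
      rw [← dvd_neg, ← conjReverse_X_pow_sub_one φ n, hk, conjReverse_mul]
      exact dvd_mul_right _ _
    refine associated_of_dvd_dvd ?_ ?_
    -- The cofactor k of g† is annihilated by g† modulo X^n - 1, so self-duality gives g ∣ k.
    · rw [hk, mul_comm]
      exact mul_dvd_mul_left _ ((hall k).2 hk.dvd)
    · rw [mul_comm]
      exact (hall g).1 dvd_rfl
  · intro h
    ext x
    rw [mem_hermitianDual_polyCode_iff hq hφ hg, mem_polyCode, ← h.dvd_iff_dvd_left, mul_comm g,
      mul_dvd_mul_iff_left hg0']

/-- Hermitian self-dual cyclic codes correspond to the monic `g` with `g * g† ∼ X ^ n - 1`. -/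
theorem ncard_selfDual_cyclic_eq [NeZero n] {q : ℕ} (hq : q ≠ 0) {φ : F →+* F}
    (hφ : ∀ x, φ x = x ^ q) :
    Set.ncard {C : Submodule F (Fin n → F) | IsCyclicCode C ∧ IsHermitianSelfDual q C} =
      Set.ncard {g : F[X] | g.Monic ∧ Associated (g * conjReverse φ g) (X ^ n - 1)} := by
  have hdvd : ∀ g : F[X], Associated (g * conjReverse φ g) (X ^ n - 1) → g ∣ X ^ n - 1 :=
    fun g h => (dvd_mul_right _ _).trans h.dvd
  have himage : {C : Submodule F (Fin n → F) | IsCyclicCode C ∧ IsHermitianSelfDual q C} =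
      polyCode n '' {g : F[X] | g.Monic ∧ Associated (g * conjReverse φ g) (X ^ n - 1)} := by
    ext C
    constructor
    · rintro ⟨hC, hsd⟩
      obtain ⟨g, hgm, hg, rfl⟩ := hC.exists_eq_polyCode
      exact ⟨g, ⟨hgm, (isHermitianSelfDual_polyCode_iff hq hφ hg).1 hsd⟩, rfl⟩
    · rintro ⟨g, ⟨_, hg⟩, rfl⟩
      exact ⟨isCyclicCode_polyCode (hdvd g hg),
        (isHermitianSelfDual_polyCode_iff hq hφ (hdvd g hg)).2 hg⟩
  have hinj : Set.InjOn (polyCode n)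
      {g : F[X] | g.Monic ∧ Associated (g * conjReverse φ g) (X ^ n - 1)} := by
    refine polyCode_injOn.mono ?_
    rintro g ⟨hgm, hg⟩
    exact ⟨hgm, hdvd g hg⟩
  rw [himage, hinj.ncard_image]

end HermitianDual

/-! ### Conjugate reciprocals and root multiplicities -/

section RootMultiplicities

open Polynomial

theorem map_conjReverse {K L : Type*} [Field K] [Field L] (i : K →+* L) {φ : K →+* K}
    {ψ : L →+* L} (h : ∀ x, i (φ x) = ψ (i x)) (g : K[X]) :
    (conjReverse φ g).map i = conjReverse ψ (g.map i) := by
  rw [conjReverse, conjReverse, reverse, reverse, ← reflect_map, Polynomial.map_map,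
    Polynomial.map_map, natDegree_map, natDegree_map, show i.comp φ = ψ.comp i from RingHom.ext h]

variable {L : Type*} [Field L] (φ : L →+* L)

theorem conjReverse_one : conjReverse φ 1 = 1 := by
  rw [conjReverse, Polynomial.map_one, ← C_1, reverse_C]

theorem conjReverse_X_sub_C {b : L} (hb : b ≠ 0) :
    conjReverse φ (X - C b) = C (-φ b) * (X - C (φ b)⁻¹) := by
  have hb' : φ b ≠ 0 := (map_ne_zero φ).2 hb
  rw [conjReverse, Polynomial.map_sub, map_X, map_C, reverse, natDegree_X_sub_C, reflect_sub,
    reflect_one_X, reflect_C, mul_sub, ← C_mul, neg_mul, mul_inv_cancel₀ hb']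
  simp only [C_neg, C_1, pow_one]
  ring

theorem associated_conjReverse_X_sub_C {b : L} (hb : b ≠ 0) :
    Associated (conjReverse φ (X - C b)) (X - C (φ b)⁻¹) := by
  rw [conjReverse_X_sub_C φ hb]
  exact associated_unit_mul_left _ _
    (isUnit_C.2 (isUnit_iff_ne_zero.2 (neg_ne_zero.2 ((map_ne_zero φ).2 hb))))

theorem eval_conjReverse_eq_zero_iff {b : L} (hb : b ≠ 0) (g : L[X]) :
    (conjReverse φ g).eval (φ b)⁻¹ = 0 ↔ g.eval b = 0 := by
  let : Invertible (φ b) := invertibleOfNonzero ((map_ne_zero φ).2 hb)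
  have h := eval₂_reverse_eq_zero_iff (RingHom.id L) (φ b) (g.map φ)
  rw [invOf_eq_inv, eval₂_id, eval₂_id, eval_map_apply, map_eq_zero] at h
  exact h

/-- Write g = (X - b)^k r with r(b) ≠ 0. Then g† is a nonzero constant times (X - (φ b)⁻¹)^k r†, and
r† does not vanish at (φ b)⁻¹. -/
theorem rootMultiplicity_conjReverse {b : L} (hb : b ≠ 0) {g : L[X]} (hg : g ≠ 0) :
    rootMultiplicity (φ b)⁻¹ (conjReverse φ g) = rootMultiplicity b g := by
  obtain ⟨r, hr, hnd⟩ := exists_eq_pow_rootMultiplicity_mul_and_not_dvd g hg b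
  rw [dvd_iff_isRoot] at hnd
  have hr0 : r ≠ 0 := by
    rintro rfl
    exact hnd (by simp)
  let f : L[X] →* L[X] := ⟨⟨conjReverse φ, conjReverse_one φ⟩, conjReverse_mul φ⟩
  have hpow : ∀ k, conjReverse φ ((X - C b) ^ k) = conjReverse φ (X - C b) ^ k :=
    fun k => map_pow f _ k
  have hc : -φ b ≠ 0 := neg_ne_zero.2 ((map_ne_zero φ).2 hb)
  conv_lhs => rw [hr]
  rw [conjReverse_mul, hpow, conjReverse_X_sub_C φ hb, mul_pow, mul_right_comm,
    rootMultiplicity_mul_X_sub_C_pow (mul_ne_zero (pow_ne_zero _ (by simpa using hc))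
      (conjReverse_ne_zero hr0)), rootMultiplicity_eq_zero, zero_add]
  rw [IsRoot, eval_mul, ← C_pow, eval_C, mul_eq_zero, not_or]
  exact ⟨pow_ne_zero _ hc, by rwa [eval_conjReverse_eq_zero_iff φ hb]⟩

theorem rootMultiplicity_prod_X_sub_C_pow {ι : Type*} [Fintype ι] {f : ι → L}
    (hf : Function.Injective f) (a : ι → ℕ) (i : ι) :
    rootMultiplicity (f i) (∏ j, (X - C (f j)) ^ a j) = a i := by
  classical
  have hne : ∀ j : ι, (X - C (f j)) ^ a j ≠ 0 := fun j => pow_ne_zero _ (X_sub_C_ne_zero _)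
  rw [← Finset.prod_erase_mul _ _ (Finset.mem_univ i),
    rootMultiplicity_mul_X_sub_C_pow (Finset.prod_ne_zero_iff.2 fun j _ => hne j),
    rootMultiplicity_eq_zero, zero_add]
  rw [IsRoot, eval_prod, Finset.prod_eq_zero_iff]
  rintro ⟨j, hj, h⟩
  rw [eval_pow, eval_sub, eval_X, eval_C] at h
  exact Finset.ne_of_mem_erase hj (hf (sub_eq_zero.1 (eq_zero_of_pow_eq_zero h)).symm)

theorem X_pow_sub_one_eq_prod_rootsOfUnity {N : ℕ} [NeZero N] [HasEnoughRootsOfUnity L N]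
    [Fintype (rootsOfUnity N L)] :
    (X ^ N - 1 : L[X]) = ∏ ω : rootsOfUnity N L, (X - C ((ω : Lˣ) : L)) := by
  obtain ⟨ζ, hζ⟩ := HasEnoughRootsOfUnity.exists_primitiveRoot L N
  rw [X_pow_sub_one_eq_prod (NeZero.pos N) hζ]
  symm
  refine Finset.prod_bij (fun ω _ => ((ω : Lˣ) : L)) ?_ ?_ ?_ ?_
  · intro ω _
    rw [mem_nthRootsFinset (NeZero.pos N)]
    exact (mem_rootsOfUnity' N _).1 ω.2
  · intro ω _ ω' _ h
    exact Subtype.ext (Units.ext h)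
  · intro x hx
    rw [mem_nthRootsFinset (NeZero.pos N)] at hx
    exact ⟨rootsOfUnity.mkOfPowEq x hx, Finset.mem_univ _, rootsOfUnity.coe_mkOfPowEq hx⟩
  · intro ω _
    rfl

/-- X^|F| - X already splits over F, so it acquires no new roots in L. -/
theorem mem_range_algebraMap_of_pow_card_eq {F L : Type*} [Field F] [Finite F] [Field L]
    [Algebra F L] {c : L} (hc : c ^ Nat.card F = c) : c ∈ (algebraMap F L).range := by
  classical
  cases nonempty_fintype F
  rw [Nat.card_eq_fintype_card] at hc
  have hcard : 1 < Fintype.card F := Fintype.one_lt_card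
  have hs : (X ^ Fintype.card F - X : F[X]).Splits := by
    rw [splits_iff_card_roots, FiniteField.roots_X_pow_card_sub_X,
      FiniteField.X_pow_card_sub_X_natDegree_eq F hcard]
    rfl
  have h := hs.roots_map (algebraMap F L)
  have hmem : c ∈ ((X ^ Fintype.card F - X : F[X]).map (algebraMap F L)).roots := by
    rw [mem_roots (Polynomial.map_ne_zero (FiniteField.X_pow_card_sub_X_ne_zero F hcard))]
    simp [hc]
  rw [h, Multiset.mem_map] at hmem
  obtain ⟨x, -, hx⟩ := hmem
  exact ⟨x, hx⟩

end RootMultiplicities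

/-! ### Generators as multiplicity functions on roots of unity -/

section Counting

open Polynomial

/-- A monic `g` with `g * g† ∼ X ^ (N * 2 ^ t) - 1` is determined by its multiplicities at the
`N`-th roots of unity, and these are arbitrary up to `a (ω) + a (ω ^ (-q)) = 2 ^ t`. -/
theorem ncard_monic_mul_conjReverse_eq {F L : Type*} [Field F] [Finite F] [Field L] [IsAlgClosed L]
    [Algebra F L] [CharP L 2] {N t q : ℕ} [NeZero N] [HasEnoughRootsOfUnity L N]
    (hcop : (Nat.card (rootsOfUnity N L)).Coprime q) (hF : Nat.card F = q ^ 2)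
    {φ : F →+* F} (hφ : ∀ x, φ x = x ^ q) {ψ : L →+* L} (hψ : ∀ x, ψ x = x ^ q) :
    Set.ncard {g : F[X] | g.Monic ∧ Associated (g * conjReverse φ g) (X ^ (N * 2 ^ t) - 1)} =
      Set.ncard {a : rootsOfUnity N L → ℕ | ∀ ω, a ω + a (negPowPerm hcop ω) = 2 ^ t} := by
  classical
  cases nonempty_fintype (rootsOfUnity N L)
  set i := algebraMap F L
  set σ := negPowPerm hcop
  let e : rootsOfUnity N L → L := fun ω => ((ω : Lˣ) : L)
  have he : Function.Injective e := fun ω ω' h => Subtype.ext (Units.ext h)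
  have he0 : ∀ ω, e ω ≠ 0 := fun ω => Units.ne_zero _
  have hσ : ∀ ω, (ψ (e ω))⁻¹ = e (σ ω) := by
    intro ω
    rw [hψ]
    simp [e, σ, negPowPerm_apply]
  have hP : (X ^ (N * 2 ^ t) - 1 : L[X]) = ∏ ω, (X - C (e ω)) ^ 2 ^ t := by
    rw [Finset.prod_pow, ← X_pow_sub_one_eq_prod_rootsOfUnity, sub_pow_char_pow, ← pow_mul,
      one_pow]
  have hmapP : (X ^ (N * 2 ^ t) - 1 : F[X]).map i = X ^ (N * 2 ^ t) - 1 := by simp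
  have hcr : ∀ g : F[X], (conjReverse φ g).map i = conjReverse ψ (g.map i) :=
    map_conjReverse i fun x => by rw [hφ, hψ, map_pow]
  -- Divisibility of polynomials is unchanged under field extension, so the condition on g may be
  -- tested over L.
  have hassoc : ∀ g : F[X], Associated (g * conjReverse φ g) (X ^ (N * 2 ^ t) - 1) ↔
      Associated (g.map i * conjReverse ψ (g.map i)) (X ^ (N * 2 ^ t) - 1) := by
    intro g
    rw [← hcr, ← hmapP, ← Polynomial.map_mul, ← dvd_dvd_iff_associated, ← dvd_dvd_iff_associated,
      map_dvd_map', map_dvd_map']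
  have hP0 : (X ^ (N * 2 ^ t) - 1 : L[X]) ≠ 0 := by
    rw [hP]
    exact Finset.prod_ne_zero_iff.2 fun ω _ => pow_ne_zero _ (X_sub_C_ne_zero _)
  let Ψ : F[X] → rootsOfUnity N L → ℕ := fun g ω => rootMultiplicity (e ω) (g.map i)
  have hinj : Set.InjOn Ψ
      {g : F[X] | g.Monic ∧ Associated (g * conjReverse φ g) (X ^ (N * 2 ^ t) - 1)} := by
    rintro g ⟨hgm, hg⟩ h ⟨hhm, hh⟩ hgh
    have hzero : ∀ f : F[X], Associated (f * conjReverse φ f) (X ^ (N * 2 ^ t) - 1) →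
        ∀ x : L, x ∉ Set.range e → rootMultiplicity x (f.map i) = 0 := by
      intro f hf x hx
      apply rootMultiplicity_eq_zero
      intro hroot
      have h1 : IsRoot (X ^ (N * 2 ^ t) - 1 : L[X]) x :=
        hroot.dvd ((dvd_mul_right _ _).trans ((hassoc f).1 hf).dvd)
      rw [hP, IsRoot, eval_prod, Finset.prod_eq_zero_iff] at h1
      obtain ⟨ω, _, hω⟩ := h1
      rw [eval_pow, eval_sub, eval_X, eval_C] at hω
      exact hx ⟨ω, (sub_eq_zero.1 (eq_zero_of_pow_eq_zero hω)).symm⟩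
    apply map_injective i i.injective
    rw [(IsAlgClosed.splits (g.map i)).eq_prod_roots_of_monic (hgm.map i),
      (IsAlgClosed.splits (h.map i)).eq_prod_roots_of_monic (hhm.map i)]
    congr 2
    ext x
    rw [count_roots, count_roots]
    by_cases hx : x ∈ Set.range e
    · obtain ⟨ω, rfl⟩ := hx
      exact congrFun hgh ω
    · rw [hzero g hg x hx, hzero h hh x hx]
  have himage : Ψ '' {g : F[X] | g.Monic ∧
      Associated (g * conjReverse φ g) (X ^ (N * 2 ^ t) - 1)} =
      {a : rootsOfUnity N L → ℕ | ∀ ω, a ω + a (σ ω) = 2 ^ t} := by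
    apply Set.Subset.antisymm
    · rintro _ ⟨g, ⟨hgm, hg⟩, rfl⟩ ω
      have hg' := (hassoc g).1 hg
      have hg0 : g.map i ≠ 0 := (hgm.map i).ne_zero
      have h1 : rootMultiplicity (e (σ ω)) (g.map i * conjReverse ψ (g.map i)) = 2 ^ t := by
        obtain ⟨u, hu⟩ := hg'.symm
        have hu0 : ((u : L[X])).rootMultiplicity (e (σ ω)) = 0 := by
          apply rootMultiplicity_eq_zero
          obtain ⟨c, hc, hcu⟩ := isUnit_iff.1 u.isUnit
          rw [← hcu, IsRoot, eval_C]
          exact hc.ne_zero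
        rw [← hu, rootMultiplicity_mul (mul_ne_zero hP0 u.ne_zero), hu0, hP,
          rootMultiplicity_prod_X_sub_C_pow he, add_zero]
      rw [rootMultiplicity_mul (mul_ne_zero hg0 (conjReverse_ne_zero hg0)), ← hσ,
        rootMultiplicity_conjReverse ψ (he0 ω) hg0, hσ, add_comm] at h1
      exact h1
    · intro a ha
      have ha' : ∀ ω, a ω + a (σ ω) = 2 ^ t := ha
      let G : L[X] := ∏ ω, (X - C (e ω)) ^ a ω
      have hGm : G.Monic := monic_prod_of_monic _ _ fun ω _ => (monic_X_sub_C _).pow _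
      have hGa : Associated (G * conjReverse ψ G) (X ^ (N * 2 ^ t) - 1) := by
        let f : L[X] →* L[X] := ⟨⟨conjReverse ψ, conjReverse_one ψ⟩, conjReverse_mul ψ⟩
        have h1 : conjReverse ψ G = ∏ ω, conjReverse ψ (X - C (e ω)) ^ a ω := by
          change f G = ∏ ω, f (X - C (e ω)) ^ a ω
          simp only [G, map_prod, map_pow]
        have h2 : Associated (conjReverse ψ G) (∏ ω, (X - C (e (σ ω))) ^ a ω) := by
          rw [h1]
          refine Associated.prod _ _ _ fun ω _ => ?_
          rw [← hσ]
          exact (associated_conjReverse_X_sub_C ψ (he0 ω)).pow_pow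
        have h3 : G = ∏ ω, (X - C (e (σ ω))) ^ a (σ ω) :=
          (Equiv.prod_comp σ fun ω => (X - C (e ω)) ^ a ω).symm
        refine (h2.mul_left G).trans ?_
        rw [hP, ← Equiv.prod_comp σ fun ω => (X - C (e ω)) ^ 2 ^ t]
        nth_rewrite 1 [h3]
        rw [← Finset.prod_mul_distrib]
        refine Associated.of_eq (Finset.prod_congr rfl fun ω _ => ?_)
        rw [← pow_add, add_comm, ha']
      -- Applying the condition on a twice gives a(σ² ω) = a(ω), so the q²-power Frobenius merely
      -- permutes the factors of G. Its coefficients are thus fixed and lie in F.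
      have hGfix : G.map (ψ.comp ψ) = G := by
        have h2 : ∀ ω, (ψ.comp ψ) (e ω) = e (σ (σ ω)) := by
          intro ω
          rw [← hσ, ← hσ, map_inv₀, inv_inv, RingHom.comp_apply]
        have h3 : ∀ ω, a ω = a (σ (σ ω)) := fun ω => by
          have := ha' ω
          have := ha' (σ ω)
          omega
        simp only [G, Polynomial.map_prod, Polynomial.map_pow, Polynomial.map_sub, map_X, map_C, h2]
        rw [← Equiv.prod_comp (σ.trans σ) fun ω => (X - C (e ω)) ^ a ω]
        exact Finset.prod_congr rfl fun ω _ => by rw [h3 ω]; rfl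
      have hlift : G ∈ lifts i := by
        rw [lifts_iff_coeff_lifts]
        intro k
        apply mem_range_algebraMap_of_pow_card_eq
        have := congrArg (fun p => p.coeff k) hGfix
        simp only [coeff_map, RingHom.comp_apply, hψ] at this
        rw [hF, sq, pow_mul, this]
      obtain ⟨g, hgG, -, hgm⟩ := lifts_and_natDegree_eq_and_monic hlift hGm
      refine ⟨g, ⟨hgm, ?_⟩, ?_⟩
      · rw [hassoc, hgG]
        exact hGa
      · funext ω
        change rootMultiplicity (e ω) (g.map i) = a ω
        rw [hgG]
        exact rootMultiplicity_prod_X_sub_C_pow he a ω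
  rw [← himage, hinj.ncard_image]

end Counting

/-! ### Integrality of the exponents and the final count -/

theorem theorem4 (m N t n : ℕ) (hm : 1 ≤ m) (hN : Odd N) (ht : 1 ≤ t) (hn : n = N * 2 ^ t)
    (F : Type*) [Field F] [Finite F] (hF : Nat.card F = 2 ^ (2 * m)) :
    (∀ d ∈ N.divisors, ¬ IsOddlyGood (2 ^ m) 1 d →
      2 * orderOf ((2 : ZMod d) ^ (2 * m)) ∣ Nat.totient d) ∧
    Set.ncard {C : Submodule F (Fin n → F) | IsCyclicCode C ∧ IsHermitianSelfDual (2 ^ m) C} =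
      (1 + 2 ^ t) ^ (∑ d ∈ N.divisors with ¬ IsOddlyGood (2 ^ m) 1 d,
        Nat.totient d / (2 * orderOf ((2 : ZMod d) ^ (2 * m)))) := by
  subst hn
  have hcast : ∀ d : ℕ, (2 : ZMod d) ^ (2 * m) = ((2 ^ m : ℕ) : ZMod d) ^ 2 := by
    intro d
    push_cast
    rw [← pow_mul, mul_comm]
  have hcop2 : (2 ^ m).Coprime N := (Nat.coprime_two_left.2 hN).pow_left m
  constructor
  · intro d hd hgood
    have h1 : Even (orderOf (-((2 ^ m : ℕ) : ZMod d))) := by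
      simpa using (not_isOddlyGood_one_iff_even_orderOf_neg (2 ^ m) d).1 hgood
    rw [hcast, ← orderOf_neg_eq_two_mul_orderOf_sq _ h1]
    exact orderOf_neg_natCast_dvd_totient (hcop2.coprime_dvd_right (Nat.dvd_of_mem_divisors hd))
  · have : NeZero N := ⟨hN.pos.ne'⟩
    have : NeZero (N * 2 ^ t) := ⟨mul_ne_zero hN.pos.ne' (by positivity)⟩
    have : Fact (Nat.Prime 2) := ⟨Nat.prime_two⟩
    have : CharP F 2 := by
      cases nonempty_fintype F
      exact charP_of_card_eq_prime_pow (f := 2 * m) (by rw [← Nat.card_eq_fintype_card, hF])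
    have : CharP (AlgebraicClosure F) 2 :=
      charP_of_injective_algebraMap (algebraMap F (AlgebraicClosure F)).injective 2
    have : NeZero (N : AlgebraicClosure F) := ⟨by
      rw [Ne, CharP.cast_eq_zero_iff (AlgebraicClosure F) 2]
      exact hN.not_two_dvd_nat⟩
    have hcard : Nat.card (rootsOfUnity N (AlgebraicClosure F)) = N :=
      HasEnoughRootsOfUnity.natCard_rootsOfUnity _ _
    have hcop : (Nat.card (rootsOfUnity N (AlgebraicClosure F))).Coprime (2 ^ m) := by
      rw [hcard]
      exact hcop2.symm
    rw [ncard_selfDual_cyclic_eq (by positivity) (φ := iterateFrobenius F 2 m)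
        (iterateFrobenius_def 2 m),
      ncard_monic_mul_conjReverse_eq (L := AlgebraicClosure F) hcop (by rw [hF, ← pow_mul, mul_comm])
        (iterateFrobenius_def 2 m) (ψ := iterateFrobenius _ 2 m) (iterateFrobenius_def 2 m)]
    -- Since t ≥ 1, the midpoint 2^(t-1) forced on odd orbits is an integer.
    have ht2 : 2 ^ t = 2 * 2 ^ (t - 1) := by
      rw [← pow_succ', Nat.sub_add_cancel ht]
    rw [ht2, ncard_add_apply_perm_eq, card_even_orbits_negPowPerm, hcard]
    simp only [hcast]
    push_cast
    rfl
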